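/- Let $N\ge 3$. Let $D^{1,2}(\mathbb R^N)$ be the completion of $C_c^\infty(\mathbb R^N)$ (real-valued functions) with respect to the norm $\|u\|_{D^{1,2}}=\left(\int_{\mathbb R^N}|\nabla u|^2\,dx\right)^{1/2}$, regarded, by the Sobolev inequality, as a space of functions in $L^{2N/(N-2)}(\mathbb R^N)$. Let $L^{N/2,\infty}(\mathbb R^N)$ be the Lorentz space of all $f\in L^1_{\rm loc}(\mathbb R^N)$ with $\sup_{t>0}t^{2/N}f^*(t)<\infty$, where $f^*(t)=\inf\{s>0:\ |\{x:|f(x)|>s\}|\le t\}$ is the nonincreasing rearrangement of $f$. Let $V_\circ,V_1\in L^{N/2,\infty}(\mathbb R^N)$ be real-valued functions, each positive on a set of positive measure, and put $$\Lambda_\circ=\inf_{u\in D^{1,2}(\mathbb R^N),\ \int V_\circ u^2\,dx=1}\int_{\mathbb R^N}|\nabla u|^2\,dx,\qquad \Lambda_1=\inf_{u\in D^{1,2}(\mathbb R^N),\ \int V_1 u^2\,dx=1}\int_{\mathbb R^N}|\nabla u|^2\,dx .$$ Assume that the functional $u\mapsto\int_{\mathbb R^N}(V_1-V_\circ)u^2\,dx$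 is weakly (sequentially) continuous on $D^{1,2}(\mathbb R^N)$, i.e. $u_k\rightharpoonup u$ in $D^{1,2}(\mathbb R^N)$ implies $\int(V_1-V_\circ)u_k^2\,dx\to\int(V_1-V_\circ)u^2\,dx$. If $\Lambda_1<\Lambda_\circ$, then there exists a minimizer for $\Lambda_1$, i.e. some $w\in D^{1,2}(\mathbb R^N)$ with $\int V_1w^2\,dx=1$ and $\int|\nabla w|^2\,dx=\Lambda_1$. Moreover, every minimizing sequence for $\Lambda_1$, i.e. every sequence $(u_k)\subset D^{1,2}(\mathbb R^N)$ with $\int V_1u_k^2\,dx=1$ for all $k$ and $\int|\nabla u_k|^2\,dx\to\Lambda_1$, has a subsequence that converges strongly in $D^{1,2}(\mathbb R^N)$ to a minimizer for $\Lambda_1$. -/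

import Mathlib

open MeasureTheory Filter Topology
open scoped ENNReal NNReal ContDiff

noncomputable section

/-- Euclidean space `ℝ^N`. -/
abbrev Eu (N : ℕ) := EuclideanSpace ℝ (Fin N)

/-! ### The Lorentz space `L^{p,∞}(ℝ^N)` -/

/-- Distribution function `α_f(s) = |{x : |f x| > s}|`. -/
def distribFun {N : ℕ} (f : Eu N → ℝ) (s : ℝ) : ℝ≥0∞ :=
  volume {x | s < |f x|}

/-- Nonincreasing rearrangement `f^*(t) = inf {s > 0 : α_f(s) ≤ t}`, with `inf ∅ = ∞`. -/
def rearrangement {N : ℕ} (f : Eu N → ℝ) (t : ℝ) : ℝ≥0∞ :=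
  ⨅ (s : ℝ) (_ : 0 < s) (_ : distribFun f s ≤ ENNReal.ofReal t), ENNReal.ofReal s

/-- The Lorentz quasi-norm `sup_{t > 0} t^{1/p} f^*(t)`. -/
def weakLorentzNorm {N : ℕ} (p : ℝ) (f : Eu N → ℝ) : ℝ≥0∞ :=
  ⨆ (t : ℝ) (_ : 0 < t), ENNReal.ofReal (t ^ (1 / p)) * rearrangement f t

/-- `f ∈ L^{p,∞}(ℝ^N)`. -/
def MemWeakLorentz {N : ℕ} (p : ℝ) (f : Eu N → ℝ) : Prop :=
  LocallyIntegrable f volume ∧ weakLorentzNorm p f < ⊤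

/-! ### The space `D^{1,2}(ℝ^N)`, `N ≥ 3` -/

/-- The critical Sobolev exponent `2N/(N-2)`. -/
def critExp (N : ℕ) : ℝ≥0 := Real.toNNReal (2 * N / (N - 2))

theorem coe_critExp (N : ℕ) [h : Fact (3 ≤ N)] : (critExp N : ℝ) = 2 * N / (N - 2) := by
  have h3 : (3 : ℝ) ≤ N := by exact_mod_cast h.out
  exact Real.coe_toNNReal _ (div_nonneg (by linarith) (by linarith))

instance fact_one_le_critExp (N : ℕ) [h : Fact (3 ≤ N)] : Fact (1 ≤ (critExp N : ℝ≥0∞)) := by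
  constructor
  have h3 : (3 : ℝ) ≤ N := by exact_mod_cast h.out
  have h1 : (1 : ℝ) ≤ critExp N := by
    rw [coe_critExp, le_div_iff₀ (by linarith)]
    linarith
  exact_mod_cast h1

theorem gradient_add_of_diff {N : ℕ} {f g : Eu N → ℝ} (hf : Differentiable ℝ f)
    (hg : Differentiable ℝ g) : gradient (f + g) = gradient f + gradient g := by
  funext x
  simp [gradient, fderiv_add (hf x) (hg x)]

theorem gradient_smul_of_diff {N : ℕ} (c : ℝ) {f : Eu N → ℝ} (hf : Differentiable ℝ f) :
    gradient (c • f) = c • gradient f := by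
  funext x
  simp [gradient, fderiv_const_smul (hf x)]

/-- The pairs `(φ, ∇φ)`, `φ ∈ C_c^∞(ℝ^N)`, as a subspace of `L^{2N/(N-2)} × L^2`. -/
def testPairs (N : ℕ) [Fact (3 ≤ N)] :
    Submodule ℝ (Lp ℝ (critExp N : ℝ≥0∞) (volume : Measure (Eu N)) ×
      Lp (Eu N) 2 (volume : Measure (Eu N))) where
  carrier := {z | ∃ φ : Eu N → ℝ, ContDiff ℝ ∞ φ ∧ HasCompactSupport φ ∧
    z.1 =ᵐ[volume] φ ∧ z.2 =ᵐ[volume] gradient φ}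
  add_mem' := by
    rintro a b ⟨φ, hφ, hφc, ha1, ha2⟩ ⟨ψ, hψ, hψc, hb1, hb2⟩
    refine ⟨φ + ψ, hφ.add hψ, hφc.add hψc, ?_, ?_⟩
    · exact (Lp.coeFn_add a.1 b.1).trans (ha1.add hb1)
    · rw [gradient_add_of_diff (hφ.differentiable (by simp)) (hψ.differentiable (by simp))]
      exact (Lp.coeFn_add a.2 b.2).trans (ha2.add hb2)
  zero_mem' := by
    refine ⟨0, contDiff_const, HasCompactSupport.zero, ?_, ?_⟩
    · exact Lp.coeFn_zero _ _ _
    · have h0 : gradient (0 : Eu N → ℝ) = 0 := by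
        funext x
        simp [gradient]
      rw [h0]
      exact Lp.coeFn_zero _ _ _
  smul_mem' := by
    rintro c a ⟨φ, hφ, hφc, ha1, ha2⟩
    refine ⟨c • φ, hφ.const_smul c, hφc.smul_left (f := fun _ => c), ?_, ?_⟩
    · exact (Lp.coeFn_smul c a.1).trans (ha1.const_smul c)
    · rw [gradient_smul_of_diff c (hφ.differentiable (by simp))]
      exact (Lp.coeFn_smul c a.2).trans (ha2.const_smul c)

/-- `D^{1,2}(ℝ^N)`, the completion of `C_c^∞(ℝ^N)` in the norm `(∫ |∇u|²)^{1/2}`, realised as a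
space of functions: the closure of the pairs `(φ, ∇φ)` in `L^{2N/(N-2)} × L^2`. By the
Sobolev inequality a sequence of test functions that is Cauchy in the gradient norm converges in
`L^{2N/(N-2)}`, so that this closure is the completion; an element is a pair `(u, ∇u)`, and it
carries the gradient norm (the instances below), not the norm of the product. -/
def D12 (N : ℕ) [Fact (3 ≤ N)] : Type := (testPairs N).topologicalClosure

namespace D12

variable {N : ℕ} [Fact (3 ≤ N)]

instance instAddCommGroup : AddCommGroup (D12 N) :=
  inferInstanceAs (AddCommGroup (testPairs N).topologicalClosure)

instance instModule : Module ℝ (D12 N) :=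
  inferInstanceAs (Module ℝ (testPairs N).topologicalClosure)

/-- The inclusion `u ↦ (u, ∇u)` of `D^{1,2}` into `L^{2N/(N-2)} × L^2`. -/
def incl : D12 N →ₗ[ℝ] Lp ℝ (critExp N : ℝ≥0∞) (volume : Measure (Eu N)) ×
    Lp (Eu N) 2 (volume : Measure (Eu N)) :=
  (testPairs N).topologicalClosure.subtype

/-- The weak gradient `∇u ∈ L^2(ℝ^N; ℝ^N)`. -/
def grad : D12 N →ₗ[ℝ] Lp (Eu N) 2 (volume : Measure (Eu N)) :=
  (LinearMap.snd ℝ _ _).comp incl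

/-- An element of `D^{1,2}` is used as a function on `ℝ^N` (defined up to null sets). -/
instance instCoeFun : CoeFun (D12 N) (fun _ => Eu N → ℝ) := ⟨fun u => (incl u).1⟩

/-- The Sobolev inequality on `D^{1,2}`. -/
theorem sobolev : ∃ C : ℝ, ∀ u : D12 N, ‖(incl u).1‖ ≤ C * ‖grad u‖ := by
  have h3 : (3 : ℝ) ≤ N := by exact_mod_cast (Fact.out : 3 ≤ N)
  refine ⟨SNormLESNormFDerivOfEqConst ℝ (volume : Measure (Eu N)) 2, fun u => ?_⟩
  set C := SNormLESNormFDerivOfEqConst ℝ (volume : Measure (Eu N)) 2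
  let S : Set (Lp ℝ (critExp N : ℝ≥0∞) (volume : Measure (Eu N)) ×
    Lp (Eu N) 2 (volume : Measure (Eu N))) := {z | ‖z.1‖ ≤ C * ‖z.2‖}
  have hS : IsClosed S := isClosed_le (by fun_prop) (by fun_prop)
  have hsub : ((testPairs N : Submodule ℝ _) : Set _) ⊆ S := by
    rintro z ⟨φ, hφ, hφc, h1, h2⟩
    have hgrad : eLpNorm (gradient φ) 2 (volume : Measure (Eu N)) =
        eLpNorm (fderiv ℝ φ) 2 volume := by
      refine eLpNorm_congr_norm_ae (Eventually.of_forall fun x => ?_)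
      simp [gradient]
    have key := eLpNorm_le_eLpNorm_fderiv_of_eq (μ := (volume : Measure (Eu N)))
      (u := φ) (p := 2) (p' := critExp N) (hφ.of_le (by exact_mod_cast le_top)) hφc
      (by norm_num) (by simp; linarith [(Fact.out : 3 ≤ N)])
      (by
        rw [coe_critExp, finrank_euclideanSpace_fin]
        have : (N : ℝ) - 2 ≠ 0 := by linarith
        have : (N : ℝ) ≠ 0 := by linarith
        push_cast
        field_simp)
    have key2 : eLpNorm z.1 (critExp N : ℝ≥0∞) volume ≤ C * eLpNorm z.2 2 volume := by
      rw [eLpNorm_congr_ae h1, eLpNorm_congr_ae h2, hgrad]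
      exact_mod_cast key
    have key3 := ENNReal.toReal_mono
      (ENNReal.mul_ne_top ENNReal.coe_ne_top (Lp.eLpNorm_ne_top z.2)) key2
    rw [ENNReal.toReal_mul] at key3
    exact key3
  exact hS.closure_subset_iff.2 hsub u.2

theorem grad_injective : Function.Injective (grad : D12 N →ₗ[ℝ] _) := by
  obtain ⟨C, hC⟩ := sobolev (N := N)
  refine (injective_iff_map_eq_zero _).2 fun u hu => ?_
  have h1 : (incl u).1 = 0 := by
    have := hC u
    rw [hu, norm_zero, mul_zero] at this
    exact norm_le_zero_iff.1 this
  exact Subtype.ext (Prod.ext h1 hu)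

/-- The norm of `D^{1,2}` is `‖u‖ = ‖∇u‖_{L²}`. -/
instance instNormedAddCommGroup : NormedAddCommGroup (D12 N) :=
  NormedAddCommGroup.induced (D12 N) _ grad grad_injective

/-- The inner product of `D^{1,2}` is `∫ ∇u · ∇v`. -/
instance instInnerProductSpace : InnerProductSpace ℝ (D12 N) where
  norm_smul_le c u := by
    change ‖grad (c • u)‖ ≤ ‖c‖ * ‖grad u‖
    rw [map_smul, norm_smul]
  inner u v := inner ℝ (grad u) (grad v)
  norm_sq_eq_re_inner u := norm_sq_eq_re_inner (𝕜 := ℝ) (grad u)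
  conj_inner_symm u v := inner_conj_symm (grad u) (grad v)
  add_left u v w := by
    change inner ℝ (grad (u + v)) (grad w) = _
    rw [map_add, inner_add_left]
  smul_left u v r := by
    change inner ℝ (grad (r • u)) (grad v) = _
    rw [map_smul, inner_smul_left]

/-- `‖u‖² = ∫ |∇u|²`. -/
theorem norm_sq_eq (u : D12 N) : ‖u‖ ^ 2 = ∫ x, ‖grad u x‖ ^ 2 := by
  change ‖grad u‖ ^ 2 = _
  rw [← real_inner_self_eq_norm_sq, L2.inner_def]
  simp

end D12

/-! ### The variational problem -/

/-- The Dirichlet energy `∫ |∇u|² dx`. -/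
def energy {N : ℕ} [Fact (3 ≤ N)] (u : D12 N) : ℝ := ∫ x, ‖D12.grad u x‖ ^ 2

/-- The potential term `∫ V u² dx`. -/
def potential {N : ℕ} [Fact (3 ≤ N)] (V : Eu N → ℝ) (u : D12 N) : ℝ := ∫ x, V x * u x ^ 2

/-- `Λ_V = inf {∫ |∇u|² : u ∈ D^{1,2}, ∫ V u² = 1}`. -/
def groundEnergy {N : ℕ} [Fact (3 ≤ N)] (V : Eu N → ℝ) : ℝ :=
  sInf (energy '' {u : D12 N | potential V u = 1})

/-- `w` is a minimizer for `Λ_V`. -/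
def IsMinimizer {N : ℕ} [Fact (3 ≤ N)] (V : Eu N → ℝ) (w : D12 N) : Prop :=
  potential V w = 1 ∧ energy w = groundEnergy V

/-- `u` is a minimizing sequence for `Λ_V`. -/
def IsMinimizingSeq {N : ℕ} [Fact (3 ≤ N)] (V : Eu N → ℝ) (u : ℕ → D12 N) : Prop :=
  (∀ k, potential V (u k) = 1) ∧ Tendsto (fun k => energy (u k)) atTop (𝓝 (groundEnergy V))

/-- Weak convergence `u_k ⇀ w` in `D^{1,2}`: convergence under every bounded linear functional. -/
def WeakConv {N : ℕ} [Fact (3 ≤ N)] (u : ℕ → D12 N) (w : D12 N) : Prop :=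
  ∀ ℓ : D12 N →L[ℝ] ℝ, Tendsto (fun k => ℓ (u k)) atTop (𝓝 (ℓ w))

/-- Weak (sequential) continuity of a functional on `D^{1,2}`. -/
def WeaklyContinuous {N : ℕ} [Fact (3 ≤ N)] (F : D12 N → ℝ) : Prop :=
  ∀ (u : ℕ → D12 N) (w : D12 N), WeakConv u w → Tendsto (fun k => F (u k)) atTop (𝓝 (F w))

end

/-!
Write `Λ₀`, `Λ₁` for the two ground energies. A minimizing sequence `u_k` for `Λ₁` is bounded, so a
subsequence converges weakly to some `w` (`D12.exists_subseq_weakConv`). Both quadratic forms split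
along weak convergence: the remainders `r_k = u_k - w` satisfy `‖r_k‖² → Λ₁ - ‖w‖²` and
`∫ V₁ r_k² → 1 - ∫ V₁ w²`. Since `u ↦ ∫ (V₁ - V₀) u²` is weakly continuous, `∫ V₀ r_k²` has the same
limit as `∫ V₁ r_k²`, so that `Λ₀ (1 - ∫ V₁ w²) ≤ Λ₁ - ‖w‖² ≤ Λ₁ (1 - ∫ V₁ w²)`. As `Λ₁ < Λ₀` this
gives `∫ V₁ w² ≥ 1`, then `‖w‖² = Λ₁`, and the remainders tend to zero in norm
(`IsMinimizingSeq.tendsto_of_weakConv`).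

The splitting of `∫ V u²`, and its very meaning as an integral, rests on the inequality
`∫ |V| u² ≤ C ∫ |∇u|²` for `V ∈ L^{N/2,∞}` (`lintegral_enorm_mul_sq_le`). It is proved without
Lorentz-space interpolation. On a superlevel set `E` of `φ²` one has `∫_E |V| ≤ C |E|^{1 - 2/N}`
(`setLIntegral_enorm_le_of_memWeakLorentz`), and the Sobolev inequality for a smooth truncation of
`φ²` between consecutive dyadic levels bounds `|E|^{1 - 2/N}` by the energy of `φ` in one dyadic layer
(`volume_superlevel_rpow_le`). The layers are disjoint, so the sum over them is the full energy.

That there are admissible functions for `Λ₁`, hence minimizing sequences, follows from testing `V₁`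
with bumps around a Lebesgue point where it is positive (`exists_potential_pos`).
-/

/-! ### Weak Lorentz functions -/

theorem distribFun_le_of_weakLorentzNorm_lt_top {N : ℕ} {p : ℝ} (hp : 0 < p) {f : Eu N → ℝ}
    (hf : weakLorentzNorm p f < ⊤) :
    ∃ M : ℝ, 0 < M ∧ ∀ s : ℝ, 0 < s → distribFun f s ≤ ENNReal.ofReal (M * s ^ (-p)) := by
  set W := (weakLorentzNorm p f).toReal with hW
  have hW0 : 0 ≤ W := ENNReal.toReal_nonneg
  refine ⟨(W + 1) ^ p, by positivity, fun s hs => ?_⟩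
  -- The level `t` is chosen so that `t ^ (1 / p) * s = W + 1` exceeds the Lorentz quasi-norm.
  set t : ℝ := (W + 1) ^ p * s ^ (-p) with ht
  have ht0 : 0 < t := by positivity
  have htp : t ^ (1 / p) * s = W + 1 := by
    rw [ht, Real.mul_rpow (by positivity) (by positivity), ← Real.rpow_mul (by positivity),
      ← Real.rpow_mul hs.le, mul_one_div_cancel hp.ne', neg_mul, mul_one_div_cancel hp.ne',
      Real.rpow_one, Real.rpow_neg_one, mul_assoc, inv_mul_cancel₀ hs.ne', mul_one]
  have h1 : ENNReal.ofReal (t ^ (1 / p)) * rearrangement f t ≤ ENNReal.ofReal W := by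
    rw [hW, ENNReal.ofReal_toReal hf.ne]
    exact le_iSup₂ (f := fun (t : ℝ) (_ : 0 < t) =>
      ENNReal.ofReal (t ^ (1 / p)) * rearrangement f t) t ht0
  have h2 : rearrangement f t < ENNReal.ofReal s := by
    by_contra! hle
    have h3 : ENNReal.ofReal (W + 1) ≤ ENNReal.ofReal W := by
      rw [← htp, ENNReal.ofReal_mul (by positivity)]
      exact (mul_le_mul_right hle _).trans h1
    rw [ENNReal.ofReal_le_ofReal_iff hW0] at h3
    linarith
  simp only [rearrangement, iInf_lt_iff] at h2
  obtain ⟨s', hs', hd, hlt⟩ := h2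
  refine le_trans (measure_mono fun x hx => ?_) hd
  exact lt_trans ((ENNReal.ofReal_lt_ofReal_iff hs).1 hlt) hx

/-- A function in `L^{p,∞}` with `p > 1` satisfies `∫_E |f| ≤ C |E|^{1 - 1/p}`. -/
theorem setLIntegral_enorm_le_of_memWeakLorentz {N : ℕ} {p : ℝ} (hp : 1 < p) {f : Eu N → ℝ}
    (hf : MemWeakLorentz p f) :
    ∃ C : ℝ≥0, ∀ E : Set (Eu N), volume E < ⊤ →
      ∫⁻ x in E, ‖f x‖ₑ ≤ C * volume E ^ (1 - 1 / p) := by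
  obtain ⟨M, hM, hd⟩ := distribFun_le_of_weakLorentzNorm_lt_top (by linarith) hf.2
  have hp1 : 0 < p - 1 := by linarith
  have hp0 : 0 < p := by linarith
  refine ⟨(1 + M / (p - 1)).toNNReal, fun E hE => ?_⟩
  rcases eq_or_ne (volume E) 0 with h0 | h0
  · rw [setLIntegral_measure_zero _ _ h0]; exact zero_le
  set v := (volume E).toReal with hv
  have hv0 : 0 < v := ENNReal.toReal_pos h0 hE.ne
  have hvE : volume E = ENNReal.ofReal v := (ENNReal.ofReal_toReal hE.ne).symm
  -- The layer-cake integral is split at the level that balances its two parts.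
  set s₀ : ℝ := v ^ (-(1 / p)) with hs₀
  have hs0 : 0 < s₀ := by positivity
  have hmeas : AEMeasurable (fun x => |f x|) (volume.restrict E) :=
    (hf.1.aestronglyMeasurable.norm.aemeasurable).restrict
  have hlay := lintegral_eq_lintegral_meas_lt (volume.restrict E)
    (Eventually.of_forall fun x => abs_nonneg (f x)) hmeas
  have hsplit : Set.Ioi (0 : ℝ) = Set.Ioc 0 s₀ ∪ Set.Ioi s₀ :=
    (Set.Ioc_union_Ioi_eq_Ioi hs0.le).symm
  have hA : ∫⁻ t in Set.Ioc 0 s₀, (volume.restrict E) {a | t < |f a|} ≤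
      ENNReal.ofReal (v ^ (1 - 1 / p)) := by
    calc ∫⁻ t in Set.Ioc 0 s₀, (volume.restrict E) {a | t < |f a|}
        ≤ ∫⁻ _ in Set.Ioc 0 s₀, volume E := by
          refine lintegral_mono fun t => (measure_mono (Set.subset_univ _)).trans ?_
          simp
      _ = ENNReal.ofReal (v * s₀) := by
          rw [setLIntegral_const, Real.volume_Ioc, hvE, ENNReal.ofReal_mul hv0.le, sub_zero]
      _ = ENNReal.ofReal (v ^ (1 - 1 / p)) := by
          rw [hs₀, sub_eq_add_neg, Real.rpow_add hv0, Real.rpow_one]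
  have hB : ∫⁻ t in Set.Ioi s₀, (volume.restrict E) {a | t < |f a|} ≤
      ENNReal.ofReal (M / (p - 1) * v ^ (1 - 1 / p)) := by
    calc ∫⁻ t in Set.Ioi s₀, (volume.restrict E) {a | t < |f a|}
        ≤ ∫⁻ t in Set.Ioi s₀, ENNReal.ofReal (M * t ^ (-p)) := by
          refine setLIntegral_mono' measurableSet_Ioi fun t ht => ?_
          exact (Measure.restrict_apply_le _ _).trans (hd t (hs0.trans ht))
      _ = ENNReal.ofReal (∫ t in Set.Ioi s₀, M * t ^ (-p)) := by
          rw [ofReal_integral_eq_lintegral_ofReal]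
          · exact (integrableOn_Ioi_rpow_of_lt (by linarith) hs0).const_mul M
          · refine (ae_restrict_iff' measurableSet_Ioi).2 (Eventually.of_forall fun t ht => ?_)
            have : 0 < t := hs0.trans ht
            positivity
      _ = ENNReal.ofReal (M / (p - 1) * v ^ (1 - 1 / p)) := by
          rw [integral_const_mul, integral_Ioi_rpow_of_lt (by linarith) hs0, hs₀,
            ← Real.rpow_mul hv0.le]
          congr 1
          have e1 : -(1 / p) * (-p + 1) = 1 - 1 / p := by field_simp; ring
          have e2 : -p + 1 = -(p - 1) := by ring
          rw [e1, e2]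
          field_simp
  calc ∫⁻ x in E, ‖f x‖ₑ = ∫⁻ x in E, ENNReal.ofReal |f x| := by
        simp only [Real.enorm_eq_ofReal_abs]
    _ ≤ ENNReal.ofReal (v ^ (1 - 1 / p)) + ENNReal.ofReal (M / (p - 1) * v ^ (1 - 1 / p)) := by
        rw [hlay, hsplit]
        exact (lintegral_union_le _ _ _).trans (add_le_add hA hB)
    _ = _ := by
        rw [← ENNReal.ofReal_add (by positivity) (by positivity), hvE,
          ENNReal.ofReal_rpow_of_pos hv0]
        change _ = ENNReal.ofReal _ * _
        rw [← ENNReal.ofReal_mul (by positivity)]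
        congr 1; ring

/-! ### The weighted inequality `∫ |V| u² ≤ C ∫ |∇u|²` -/

theorem deriv_smoothTransition_eq_zero {x : ℝ} (hx : x ∉ Set.Ico (0 : ℝ) 1) :
    deriv Real.smoothTransition x = 0 := by
  rw [Set.mem_Ico, not_and_or, not_le, not_lt] at hx
  rcases hx with hx | hx
  · refine IsLocalMin.deriv_eq_zero (Eventually.of_forall fun y => ?_)
    rw [Real.smoothTransition.zero_of_nonpos hx.le]
    exact Real.smoothTransition.nonneg y
  · refine IsLocalMax.deriv_eq_zero (Eventually.of_forall fun y => ?_)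
    rw [Real.smoothTransition.one_of_one_le hx]
    exact Real.smoothTransition.le_one y

theorem exists_bound_deriv_smoothTransition :
    ∃ K : ℝ, 0 ≤ K ∧ ∀ x, |deriv Real.smoothTransition x| ≤ K := by
  have hc : Continuous (deriv Real.smoothTransition) :=
    (Real.smoothTransition.contDiff (n := 1)).continuous_deriv le_rfl
  obtain ⟨K, hK⟩ := (isCompact_Icc (a := (0 : ℝ)) (b := 1)).exists_bound_of_continuousOn
    hc.continuousOn
  have hK0 : 0 ≤ K := (norm_nonneg _).trans (hK 0 (by simp))
  refine ⟨K, hK0, fun x => ?_⟩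
  by_cases hx : x ∈ Set.Icc (0 : ℝ) 1
  · exact hK x hx
  rw [deriv_smoothTransition_eq_zero fun h => hx (Set.Ico_subset_Icc_self h), abs_zero]
  exact hK0

/-- A capacitary estimate: applying the Sobolev inequality to a smooth truncation of `φ²` between
the levels `a` and `2a` bounds the measure of the superlevel set `{φ² ≥ 2a}` by the energy of `φ`
on the layer `{a ≤ φ² < 2a}` only. -/
theorem volume_superlevel_rpow_le (N : ℕ) [Fact (3 ≤ N)] :
    ∃ C : ℝ≥0, ∀ φ : Eu N → ℝ, ContDiff ℝ ∞ φ → HasCompactSupport φ → ∀ a : ℝ, 0 < a →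
      volume {x | 2 * a ≤ φ x ^ 2} ^ (1 - 1 / ((N : ℝ) / 2)) ≤
        C * ENNReal.ofReal a⁻¹ * ∫⁻ x in {x | a ≤ φ x ^ 2 ∧ φ x ^ 2 < 2 * a},
          ‖fderiv ℝ φ x‖ₑ ^ 2 := by
  have h3 : (3 : ℝ) ≤ N := by exact_mod_cast (Fact.out : 3 ≤ N)
  obtain ⟨K, hK0, hK⟩ := exists_bound_deriv_smoothTransition
  set S := SNormLESNormFDerivOfEqConst ℝ (volume : Measure (Eu N)) 2
  refine ⟨S ^ 2 * (8 * K ^ 2).toNNReal, fun φ hφ hφc a ha => ?_⟩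
  set A : Set (Eu N) := {x | a ≤ φ x ^ 2 ∧ φ x ^ 2 < 2 * a} with hA
  have hAm : MeasurableSet A :=
    (measurableSet_le measurable_const (hφ.continuous.measurable.pow_const 2)).inter
      (measurableSet_lt (hφ.continuous.measurable.pow_const 2) measurable_const)
  set g : Eu N → ℝ := fun x => Real.smoothTransition (φ x ^ 2 / a - 1) with hg
  have hφ1 : ContDiff ℝ 1 φ := hφ.of_le (by exact_mod_cast le_top)
  have hgc : ContDiff ℝ 1 g :=
    Real.smoothTransition.contDiff.comp (((hφ1.pow 2).div_const a).sub contDiff_const)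
  have hgs : HasCompactSupport g := by
    refine hφc.mono fun x hx => ?_
    rw [Function.mem_support] at hx ⊢
    contrapose! hx
    simp only [hg, hx]
    exact Real.smoothTransition.zero_of_nonpos (by simp)
  have hq : (critExp N : ℝ) = 2 * N / (N - 2) := coe_critExp N
  have hq0 : 0 < (critExp N : ℝ) := by rw [hq]; apply div_pos <;> linarith
  have hsob := eLpNorm_le_eLpNorm_fderiv_of_eq (μ := (volume : Measure (Eu N)))
      (u := g) (p := 2) (p' := critExp N) hgc hgs
      (by norm_num) (by simp; linarith [(Fact.out : 3 ≤ N)])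
      (by
        rw [coe_critExp, finrank_euclideanSpace_fin]
        have : (N : ℝ) - 2 ≠ 0 := by linarith
        have : (N : ℝ) ≠ 0 := by linarith
        push_cast
        field_simp)
  have hcheb : volume {x | 2 * a ≤ φ x ^ 2} ≤
      eLpNorm g (critExp N) volume ^ (critExp N : ℝ) := by
    have h := mul_meas_ge_le_pow_eLpNorm' (volume : Measure (Eu N))
      (p := (critExp N : ℝ≥0∞)) (by
        have : critExp N ≠ 0 := fun h => by simp [h] at hq0
        exact_mod_cast this) ENNReal.coe_ne_top
      hgc.continuous.aestronglyMeasurable 1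
    rw [ENNReal.one_rpow, one_mul] at h
    refine (measure_mono fun x hx => ?_).trans h
    have h1 : g x = 1 := by
      refine Real.smoothTransition.one_of_one_le ?_
      have : 2 ≤ φ x ^ 2 / a := (le_div_iff₀ ha).2 hx
      linarith
    simp [h1]
  have hexp : 1 - 1 / ((N : ℝ) / 2) = 2 / (critExp N : ℝ) := by
    rw [hq]; field_simp
  have hgrad : ∀ x, ‖fderiv ℝ g x‖ₑ ^ 2 ≤
      A.indicator (fun x => ((8 * K ^ 2).toNNReal : ℝ≥0∞) * ENNReal.ofReal a⁻¹ *
        ‖fderiv ℝ φ x‖ₑ ^ 2) x := by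
    intro x
    have hd : HasFDerivAt g (deriv Real.smoothTransition (φ x ^ 2 / a - 1) •
        ((2 * φ x / a) • fderiv ℝ φ x)) x := by
      have h1 : HasFDerivAt φ (fderiv ℝ φ x) x :=
        (hφ1.differentiable one_ne_zero x).hasFDerivAt
      have h2 : HasFDerivAt (fun y => φ y ^ 2 / a - 1) ((2 * φ x / a) • fderiv ℝ φ x) x := by
        have := ((h1.pow 2).mul_const a⁻¹).sub_const 1
        simp only [← div_eq_mul_inv] at this
        convert! this using 1
        ext y
        simp
        ring
      exact ((Real.smoothTransition.contDiff (n := 1)).differentiable one_ne_zero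
        _).hasDerivAt.comp_hasFDerivAt x h2
    rw [hd.fderiv]
    by_cases hx : x ∈ A
    · rw [Set.indicator_of_mem hx, enorm_smul, enorm_smul, ← mul_assoc, mul_pow]
      gcongr
      rw [← enorm_mul, ← enorm_pow, Real.enorm_eq_ofReal_abs]
      change _ ≤ ENNReal.ofReal _ * _
      rw [← ENNReal.ofReal_mul (by positivity)]
      apply ENNReal.ofReal_le_ofReal
      rw [abs_pow, sq_abs, mul_pow, div_pow, mul_pow, ← sq_abs (deriv _ _)]
      have h4 : |deriv Real.smoothTransition (φ x ^ 2 / a - 1)| ^ 2 ≤ K ^ 2 :=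
        pow_le_pow_left₀ (abs_nonneg _) (hK _) 2
      have h5 : 2 ^ 2 * φ x ^ 2 / a ^ 2 ≤ 8 * a⁻¹ := by
        rw [div_le_iff₀ (by positivity)]
        have : 8 * a⁻¹ * a ^ 2 = 8 * a := by field_simp
        rw [this]; linarith [hx.2]
      calc _ ≤ K ^ 2 * (8 * a⁻¹) := mul_le_mul h4 h5 (by positivity) (by positivity)
        _ = _ := by ring
    · have : deriv Real.smoothTransition (φ x ^ 2 / a - 1) = 0 := by
        refine deriv_smoothTransition_eq_zero fun h => hx ?_
        constructor
        · have : 1 ≤ φ x ^ 2 / a := by linarith [h.1]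
          simpa using (le_div_iff₀ ha).1 this
        · exact (div_lt_iff₀ ha).1 (by linarith [h.2])
      rw [enorm_smul, this, enorm_zero, zero_mul]
      simp
  calc volume {x | 2 * a ≤ φ x ^ 2} ^ (1 - 1 / ((N : ℝ) / 2))
      ≤ (eLpNorm g (critExp N) volume ^ (critExp N : ℝ)) ^ (2 / (critExp N : ℝ)) := by
        rw [hexp]; gcongr
    _ = eLpNorm g (critExp N) volume ^ 2 := by
        rw [← ENNReal.rpow_mul, mul_div_cancel₀ _ hq0.ne', ENNReal.rpow_ofNat]
    _ ≤ (S * eLpNorm (fderiv ℝ g) 2 volume) ^ 2 := by gcongr; exact_mod_cast hsob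
    _ = S ^ 2 * ∫⁻ x, ‖fderiv ℝ g x‖ₑ ^ 2 := by
        rw [mul_pow]
        congr 1
        rw [eLpNorm_eq_lintegral_rpow_enorm_toReal (by norm_num) (by norm_num)]
        rw [← ENNReal.rpow_natCast, ← ENNReal.rpow_mul]
        simp
    _ ≤ S ^ 2 * ∫⁻ x in A, ((8 * K ^ 2).toNNReal : ℝ≥0∞) * ENNReal.ofReal a⁻¹ *
        ‖fderiv ℝ φ x‖ₑ ^ 2 := by
        rw [← lintegral_indicator hAm]
        gcongr with x
        exact hgrad x
    _ = _ := by
        rw [lintegral_const_mul' _ _ (by finiteness)]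
        push_cast
        ring

/-- The weighted inequality for test functions: the mass of `|V| φ²` in each dyadic layer of `φ²`
is controlled by the energy of `φ` in the preceding layer, and the layers are disjoint. -/
theorem lintegral_enorm_mul_sq_le_of_test {N : ℕ} [Fact (3 ≤ N)] {V : Eu N → ℝ}
    (hV : MemWeakLorentz ((N : ℝ) / 2) V) :
    ∃ C : ℝ≥0, ∀ φ : Eu N → ℝ, ContDiff ℝ ∞ φ → HasCompactSupport φ →
      ∫⁻ x, ‖V x‖ₑ * ‖φ x‖ₑ ^ 2 ≤ C * ∫⁻ x, ‖fderiv ℝ φ x‖ₑ ^ 2 := by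
  have h3 : (3 : ℝ) ≤ N := by exact_mod_cast (Fact.out : 3 ≤ N)
  obtain ⟨C₁, hC₁⟩ := setLIntegral_enorm_le_of_memWeakLorentz (by linarith) hV
  obtain ⟨C₂, hC₂⟩ := volume_superlevel_rpow_le N
  refine ⟨4 * C₁ * C₂, fun φ hφ hφc => ?_⟩
  set A : ℤ → Set (Eu N) := fun k => {x | (2 : ℝ) ^ k ≤ φ x ^ 2 ∧ φ x ^ 2 < 2 * 2 ^ k} with hA
  have hAm : ∀ k, MeasurableSet (A k) := fun k =>
    (measurableSet_le measurable_const (hφ.continuous.measurable.pow_const 2)).inter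
      (measurableSet_lt (hφ.continuous.measurable.pow_const 2) measurable_const)
  have h2 : ∀ k : ℤ, (2 : ℝ) * 2 ^ k = 2 ^ (k + 1) := fun k => by
    rw [zpow_add_one₀ two_ne_zero, mul_comm]
  have hdisj : Pairwise (Function.onFun Disjoint A) := by
    have key : ∀ i j, i < j → Disjoint (A i) (A j) := by
      intro i j hij
      refine Set.disjoint_left.2 fun x hi hj => ?_
      have h4 := hi.2
      rw [h2] at h4
      have h5 : (2 : ℝ) ^ (i + 1) ≤ 2 ^ j := zpow_le_zpow_right₀ one_le_two hij
      linarith [hj.1]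
    intro i j hij
    rcases hij.lt_or_gt with h | h
    · exact key i j h
    · exact (key j i h).symm
  have hcover : Function.support (fun x => ‖V x‖ₑ * ‖φ x‖ₑ ^ 2) ⊆ ⋃ k, A (k + 1) := by
    intro x hx
    have hx0 : φ x ≠ 0 := fun h => hx (by simp [h])
    obtain ⟨n, hn⟩ := exists_mem_Ico_zpow (y := (2 : ℝ)) (sq_pos_of_ne_zero hx0) one_lt_two
    refine Set.mem_iUnion.2 ⟨n - 1, ?_⟩
    simp only [sub_add_cancel]
    exact ⟨hn.1, by rw [h2]; exact hn.2⟩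
  have hlayer : ∀ k : ℤ, ∫⁻ x in A (k + 1), ‖V x‖ₑ * ‖φ x‖ₑ ^ 2 ≤
      (4 * C₁ * C₂ : ℝ≥0) * ∫⁻ x in A k, ‖fderiv ℝ φ x‖ₑ ^ 2 := by
    intro k
    have hk : (0 : ℝ) < 2 ^ k := by positivity
    set E : Set (Eu N) := {x | 2 * 2 ^ k ≤ φ x ^ 2} with hE
    have hEfin : volume E < ⊤ := by
      refine (measure_mono ?_).trans_lt hφc.isCompact.measure_lt_top
      refine fun x hx => subset_tsupport _ fun h => ?_
      have : 2 * (2 : ℝ) ^ k ≤ φ x ^ 2 := hx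
      rw [h] at this
      nlinarith
    calc ∫⁻ x in A (k + 1), ‖V x‖ₑ * ‖φ x‖ₑ ^ 2
        ≤ ∫⁻ x in A (k + 1), ‖V x‖ₑ * ENNReal.ofReal (4 * 2 ^ k) := by
          refine setLIntegral_mono' (hAm _) fun x hx => ?_
          gcongr
          rw [← enorm_pow, Real.enorm_eq_ofReal_abs, abs_of_nonneg (sq_nonneg _)]
          refine ENNReal.ofReal_le_ofReal ?_
          have := hx.2
          rw [← h2] at this
          linarith
      _ ≤ ∫⁻ x in E, ‖V x‖ₑ * ENNReal.ofReal (4 * 2 ^ k) := by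
          refine lintegral_mono_set fun x hx => ?_
          have := hx.1
          rw [← h2] at this
          exact this
      _ = (∫⁻ x in E, ‖V x‖ₑ) * ENNReal.ofReal (4 * 2 ^ k) :=
          lintegral_mul_const' _ _ ENNReal.ofReal_ne_top
      _ ≤ C₁ * (C₂ * ENNReal.ofReal (2 ^ k)⁻¹ * ∫⁻ x in A k, ‖fderiv ℝ φ x‖ₑ ^ 2) *
          ENNReal.ofReal (4 * 2 ^ k) := by
          gcongr
          exact (hC₁ E hEfin).trans (by gcongr; exact hC₂ φ hφ hφc _ hk)
      _ = (C₁ * C₂ * ∫⁻ x in A k, ‖fderiv ℝ φ x‖ₑ ^ 2) *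
          (ENNReal.ofReal (2 ^ k)⁻¹ * ENNReal.ofReal (4 * 2 ^ k)) := by ring
      _ = _ := by
          rw [← ENNReal.ofReal_mul (by positivity)]
          have : ((2 : ℝ) ^ k)⁻¹ * (4 * 2 ^ k) = 4 := by field_simp
          rw [this]
          push_cast
          simp only [ENNReal.ofReal_ofNat]
          ring
  calc ∫⁻ x, ‖V x‖ₑ * ‖φ x‖ₑ ^ 2
      = ∫⁻ x in ⋃ k, A (k + 1), ‖V x‖ₑ * ‖φ x‖ₑ ^ 2 := by
        rw [← lintegral_indicator (MeasurableSet.iUnion fun k => hAm _),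
          Set.indicator_eq_self.2 hcover]
    _ ≤ ∑' k, ∫⁻ x in A (k + 1), ‖V x‖ₑ * ‖φ x‖ₑ ^ 2 := lintegral_iUnion_le _ _
    _ ≤ ∑' k, (4 * C₁ * C₂ : ℝ≥0) * ∫⁻ x in A k, ‖fderiv ℝ φ x‖ₑ ^ 2 :=
        ENNReal.tsum_le_tsum hlayer
    _ = (4 * C₁ * C₂ : ℝ≥0) * ∫⁻ x in ⋃ k, A k, ‖fderiv ℝ φ x‖ₑ ^ 2 := by
        rw [ENNReal.tsum_mul_left, lintegral_iUnion hAm hdisj]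
    _ ≤ _ := by gcongr; exact Measure.restrict_le_self

/-! ### Hilbert space structure of `D^{1,2}` -/

namespace D12

variable {N : ℕ} [Fact (3 ≤ N)]

theorem isometry_grad : Isometry (grad : D12 N →ₗ[ℝ] _) :=
  AddMonoidHomClass.isometry_of_norm _ fun _ => rfl

theorem energy_eq (u : D12 N) : energy u = ‖u‖ ^ 2 := (norm_sq_eq u).symm

theorem coeFn_add (u v : D12 N) : ⇑(incl (u + v)).1 =ᵐ[volume] fun x => u x + v x := by
  rw [map_add]
  exact Lp.coeFn_add _ _

theorem coeFn_smul (c : ℝ) (u : D12 N) : ⇑(incl (c • u)).1 =ᵐ[volume] fun x => c * u x := by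
  rw [map_smul]
  exact Lp.coeFn_smul _ _

theorem aestronglyMeasurable (u : D12 N) : AEStronglyMeasurable (fun x => u x) volume :=
  Lp.aestronglyMeasurable _

/-- By the Sobolev inequality a Cauchy sequence for the gradient norm is Cauchy for the product
norm, in which the space is closed. -/
instance : CompleteSpace (D12 N) := by
  refine Metric.complete_of_cauchySeq_tendsto fun u hu => ?_
  obtain ⟨C, hC⟩ := sobolev (N := N)
  have h2 : CauchySeq fun n => grad (u n) := hu.map isometry_grad.uniformContinuous
  have hl : LipschitzWith C.toNNReal fun u : D12 N => (incl u).1 := by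
    refine LipschitzWith.of_dist_le_mul fun u v => ?_
    rw [dist_eq_norm, dist_eq_norm]
    have h := hC (u - v)
    rw [map_sub] at h
    exact h.trans (mul_le_mul_of_nonneg_right (Real.le_coe_toNNReal C) (norm_nonneg _))
  have h1 : CauchySeq fun n => (incl (u n)).1 := hu.map hl.uniformContinuous
  obtain ⟨z, hz⟩ := cauchySeq_tendsto_of_complete (h1.prodMk h2)
  have hmem : z ∈ (testPairs N).topologicalClosure :=
    (testPairs N).isClosed_topologicalClosure.mem_of_tendsto hz
      (Eventually.of_forall fun n => (u n).2)
  refine ⟨⟨z, hmem⟩, isometry_grad.isEmbedding.tendsto_nhds_iff.2 ?_⟩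
  exact (continuous_snd.tendsto z).comp hz

instance : TopologicalSpace.SeparableSpace (D12 N) := by
  have : Fact ((2 : ℝ≥0∞) ≠ ⊤) := ⟨by norm_num⟩
  have := (isometry_grad (N := N)).isEmbedding.secondCountableTopology
  infer_instance

/-- Bounded sequences in `D^{1,2}` have weakly convergent subsequences. -/
theorem exists_subseq_weakConv {u : ℕ → D12 N} {R : ℝ} (hR : ∀ k, ‖u k‖ ≤ R) :
    ∃ (ψ : ℕ → ℕ) (w : D12 N), StrictMono ψ ∧ WeakConv (fun k => u (ψ k)) w := by
  let T := InnerProductSpace.toDual ℝ (D12 N)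
  obtain ⟨a, -, ψ, hψ, hlim⟩ := WeakDual.isSeqCompact_closedBall ℝ (D12 N) 0 R
    (x := fun k => StrongDual.toWeakDual (T (u k))) (fun k => by
      simpa using hR k)
  refine ⟨ψ, T.symm (WeakDual.toStrongDual a), hψ, fun ℓ => ?_⟩
  -- Every bounded functional is `v ↦ ⟪y, v⟫`, and by symmetry it is evaluation at `y`.
  obtain ⟨y, rfl⟩ := T.surjective ℓ
  have h := ((WeakDual.eval_continuous (𝕜 := ℝ) y).tendsto a).comp hlim
  have e : T y (T.symm (WeakDual.toStrongDual a)) = a y := by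
    rw [InnerProductSpace.toDual_apply_apply, real_inner_comm,
      ← InnerProductSpace.toDual_apply_apply (𝕜 := ℝ), T.apply_symm_apply]
    rfl
  rw [e]
  refine h.congr fun k => ?_
  change inner ℝ (u (ψ k)) y = inner ℝ y (u (ψ k))
  exact real_inner_comm _ _

end D12

theorem WeakConv.norm_sub_sq_tendsto {N : ℕ} [Fact (3 ≤ N)] {u : ℕ → D12 N} {w : D12 N} {c : ℝ}
    (hu : WeakConv u w) (hc : Tendsto (fun k => ‖u k‖ ^ 2) atTop (𝓝 c)) :
    Tendsto (fun k => ‖u k - w‖ ^ 2) atTop (𝓝 (c - ‖w‖ ^ 2)) := by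
  have h := (hc.sub ((hu (innerSL ℝ w)).const_mul 2)).add_const (‖w‖ ^ 2)
  simp only [innerSL_apply_apply] at h
  rw [real_inner_self_eq_norm_sq] at h
  convert h using 2
  · rw [norm_sub_sq_real, real_inner_comm]
  · ring

/-! ### The potential term as a quadratic form -/

section Potential

variable {N : ℕ} [Fact (3 ≤ N)] {V : Eu N → ℝ}

/-- The weighted inequality on `D^{1,2}`, obtained from test functions by Fatou's lemma. -/
theorem lintegral_enorm_mul_sq_le (hV : MemWeakLorentz ((N : ℝ) / 2) V) :
    ∃ C : ℝ≥0, ∀ u : D12 N, ∫⁻ x, ‖V x‖ₑ * ‖u x‖ₑ ^ 2 ≤ C * ‖D12.grad u‖ₑ ^ 2 := by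
  obtain ⟨C, hC⟩ := lintegral_enorm_mul_sq_le_of_test hV
  refine ⟨C, fun u => ?_⟩
  have htest : ∀ z ∈ testPairs N, ∫⁻ x, ‖V x‖ₑ * ‖z.1 x‖ₑ ^ 2 ≤ C * ‖z.2‖ₑ ^ 2 := by
    rintro z ⟨φ, hφ, hφc, h1, h2⟩
    have e1 : ∫⁻ x, ‖V x‖ₑ * ‖z.1 x‖ₑ ^ 2 = ∫⁻ x, ‖V x‖ₑ * ‖φ x‖ₑ ^ 2 :=
      lintegral_congr_ae (h1.mono fun x hx => by simp only [hx])
    have e2 : ‖z.2‖ₑ ^ 2 = ∫⁻ x, ‖fderiv ℝ φ x‖ₑ ^ 2 := by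
      rw [Lp.enorm_def, eLpNorm_congr_ae h2,
        eLpNorm_eq_lintegral_rpow_enorm_toReal (by norm_num) (by norm_num),
        ← ENNReal.rpow_natCast, ← ENNReal.rpow_mul]
      simp [gradient]
    rw [e1, e2]
    exact hC φ hφ hφc
  obtain ⟨z, hz, hlim⟩ := mem_closure_iff_seq_limit.1 u.2
  have hlim1 : Tendsto (fun n => (z n).1) atTop (𝓝 (D12.incl u).1) :=
    (continuous_fst.tendsto _).comp hlim
  have hlim2 : Tendsto (fun n => (z n).2) atTop (𝓝 (D12.grad u)) :=
    (continuous_snd.tendsto _).comp hlim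
  obtain ⟨ns, hns, hae⟩ := (tendstoInMeasure_of_tendsto_Lp hlim1).exists_seq_tendsto_ae
  have hVm : AEMeasurable (fun x => ‖V x‖ₑ) volume := hV.1.aestronglyMeasurable.enorm
  calc ∫⁻ x, ‖V x‖ₑ * ‖u x‖ₑ ^ 2
      = ∫⁻ x, liminf (fun n => ‖V x‖ₑ * ‖(z (ns n)).1 x‖ₑ ^ 2) atTop := by
        refine lintegral_congr_ae (hae.mono fun x hx => ?_)
        exact (ENNReal.Tendsto.const_mul (((ENNReal.continuous_pow 2).tendsto _).comp hx.enorm)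
          (Or.inr enorm_ne_top)).liminf_eq.symm
    _ ≤ liminf (fun n => ∫⁻ x, ‖V x‖ₑ * ‖(z (ns n)).1 x‖ₑ ^ 2) atTop :=
        lintegral_liminf_le' fun n =>
          hVm.mul ((Lp.aestronglyMeasurable (z (ns n)).1).enorm.pow_const 2)
    _ ≤ liminf (fun n => C * ‖(z (ns n)).2‖ₑ ^ 2) atTop :=
        liminf_le_liminf (Eventually.of_forall fun n => htest _ (hz _))
    _ = C * ‖D12.grad u‖ₑ ^ 2 :=
        (ENNReal.Tendsto.const_mul (((ENNReal.continuous_pow 2).tendsto _).comp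
          (hlim2.comp hns.tendsto_atTop).enorm) (Or.inr ENNReal.coe_ne_top)).liminf_eq

theorem integrable_mul_sq (hV : MemWeakLorentz ((N : ℝ) / 2) V) (u : D12 N) :
    Integrable fun x => V x * u x ^ 2 := by
  obtain ⟨C, hC⟩ := lintegral_enorm_mul_sq_le hV
  refine ⟨hV.1.aestronglyMeasurable.mul (u.aestronglyMeasurable.pow 2), ?_⟩
  refine lt_of_le_of_lt ?_ ((hC u).trans_lt (by finiteness))
  simp only [enorm_mul, enorm_pow, le_refl]

theorem exists_abs_potential_le (hV : MemWeakLorentz ((N : ℝ) / 2) V) :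
    ∃ C : ℝ, 0 ≤ C ∧ ∀ u : D12 N, ∫ x, |V x * u x ^ 2| ≤ C * ‖u‖ ^ 2 := by
  obtain ⟨C, hC⟩ := lintegral_enorm_mul_sq_le hV
  refine ⟨C, C.2, fun u => ?_⟩
  have h := ENNReal.toReal_mono (by finiteness) (hC u)
  simp only [← Real.norm_eq_abs]
  rw [integral_norm_eq_lintegral_enorm (integrable_mul_sq hV u).1]
  simp only [enorm_mul, enorm_pow]
  refine h.trans (le_of_eq ?_)
  simp only [ENNReal.toReal_mul, ENNReal.coe_toReal, ENNReal.toReal_pow, toReal_enorm]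
  rfl

theorem integrable_mul_mul (hV : MemWeakLorentz ((N : ℝ) / 2) V) (u v : D12 N) :
    Integrable fun x => V x * (u x * v x) := by
  refine ((integrable_mul_sq hV u).norm.add (integrable_mul_sq hV v).norm).mono'
    (hV.1.aestronglyMeasurable.mul (u.aestronglyMeasurable.mul v.aestronglyMeasurable))
    (Eventually.of_forall fun x => ?_)
  simp only [Pi.add_apply, Real.norm_eq_abs, abs_mul, abs_pow]
  nlinarith [mul_nonneg (abs_nonneg (V x)) (sq_nonneg (|u x| - |v x|)),
    mul_nonneg (abs_nonneg (V x)) (sq_nonneg (|u x| + |v x|))]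

/-- For fixed `u`, the polarization `v ↦ ∫ V u v` of the potential term is a bounded functional. -/
theorem exists_potential_polarization (hV : MemWeakLorentz ((N : ℝ) / 2) V) (u : D12 N) :
    ∃ ℓ : D12 N →L[ℝ] ℝ, ∀ v, ℓ v = ∫ x, V x * (u x * v x) := by
  let ℓ₀ : D12 N →ₗ[ℝ] ℝ :=
    { toFun := fun v => ∫ x, V x * (u x * v x)
      map_add' := fun v w => by
        rw [← integral_add (integrable_mul_mul hV u v) (integrable_mul_mul hV u w)]
        refine integral_congr_ae ((D12.coeFn_add v w).mono fun x hx => ?_)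
        simp only [hx]
        ring
      map_smul' := fun c v => by
        rw [RingHom.id_apply, smul_eq_mul, ← integral_const_mul]
        refine integral_congr_ae ((D12.coeFn_smul c v).mono fun x hx => ?_)
        simp only [hx]
        ring }
  obtain ⟨C, hC0, hC⟩ := exists_abs_potential_le hV
  have hball : ∀ v ∈ Metric.ball (0 : D12 N) 1, ‖ℓ₀ v‖ ≤ C * ‖u‖ ^ 2 + C := by
    intro v hv
    have hv1 : ‖v‖ ≤ 1 := (mem_ball_zero_iff.1 hv).le
    have hv2 : ‖v‖ ^ 2 ≤ 1 := pow_le_one₀ (norm_nonneg _) hv1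
    calc ‖ℓ₀ v‖ ≤ ∫ x, (|V x * u x ^ 2| + |V x * v x ^ 2|) := by
          refine norm_integral_le_of_norm_le
            ((integrable_mul_sq hV u).abs.add (integrable_mul_sq hV v).abs)
            (Eventually.of_forall fun x => ?_)
          simp only [Real.norm_eq_abs, abs_mul, abs_pow]
          nlinarith [mul_nonneg (abs_nonneg (V x)) (sq_nonneg (|u x| - |v x|)),
            mul_nonneg (abs_nonneg (V x)) (sq_nonneg (|u x| + |v x|))]
      _ = (∫ x, |V x * u x ^ 2|) + ∫ x, |V x * v x ^ 2| :=
          integral_add (integrable_mul_sq hV u).abs (integrable_mul_sq hV v).abs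
      _ ≤ C * ‖u‖ ^ 2 + C * ‖v‖ ^ 2 := add_le_add (hC u) (hC v)
      _ ≤ _ := by nlinarith
  obtain ⟨K, hK⟩ := LinearMap.bound_of_ball_bound one_pos _ ℓ₀ hball
  exact ⟨ℓ₀.mkContinuous K hK, fun v => rfl⟩

theorem potential_add (hV : MemWeakLorentz ((N : ℝ) / 2) V) (u v : D12 N) :
    potential V (u + v) =
      potential V u + 2 * (∫ x, V x * (u x * v x)) + potential V v := by
  have h1 := integral_add (integrable_mul_sq hV u) ((integrable_mul_mul hV u v).const_mul 2)
  have h2 := integral_add ((integrable_mul_sq hV u).add ((integrable_mul_mul hV u v).const_mul 2))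
    (integrable_mul_sq hV v)
  simp only [Pi.add_apply] at h2
  unfold potential
  rw [← integral_const_mul, ← h1, ← h2]
  refine integral_congr_ae ((D12.coeFn_add u v).mono fun x hx => ?_)
  simp only [hx]
  ring

theorem potential_smul (V : Eu N → ℝ) (c : ℝ) (u : D12 N) :
    potential V (c • u) = c ^ 2 * potential V u := by
  unfold potential
  rw [← integral_const_mul]
  refine integral_congr_ae ((D12.coeFn_smul c u).mono fun x hx => ?_)
  simp only [hx]
  ring

theorem potential_sub_potential {V₀ V₁ : Eu N → ℝ} (hV₀ : MemWeakLorentz ((N : ℝ) / 2) V₀)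
    (hV₁ : MemWeakLorentz ((N : ℝ) / 2) V₁) (u : D12 N) :
    potential (fun x => V₁ x - V₀ x) u = potential V₁ u - potential V₀ u := by
  unfold potential
  rw [← integral_sub (integrable_mul_sq hV₁ u) (integrable_mul_sq hV₀ u)]
  simp only [sub_mul]

theorem WeakConv.potential_sub_tendsto (hV : MemWeakLorentz ((N : ℝ) / 2) V) {u : ℕ → D12 N}
    {w : D12 N} {c : ℝ} (hu : WeakConv u w)
    (hc : Tendsto (fun k => potential V (u k)) atTop (𝓝 c)) :
    Tendsto (fun k => potential V (u k - w)) atTop (𝓝 (c - potential V w)) := by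
  obtain ⟨ℓ, hℓ⟩ := exists_potential_polarization hV w
  have hlim := (hu ℓ).sub_const (ℓ w)
  rw [sub_self] at hlim
  have h := (hc.sub_const (potential V w)).sub (hlim.const_mul 2)
  rw [mul_zero, sub_zero] at h
  refine h.congr fun k => ?_
  have e := potential_add hV w (u k - w)
  rw [add_sub_cancel, ← hℓ, map_sub] at e
  linarith

/-! ### The ground energy -/

theorem groundEnergy_nonneg (V : Eu N → ℝ) : 0 ≤ groundEnergy V := by
  refine Real.sInf_nonneg ?_
  rintro _ ⟨u, -, rfl⟩
  rw [D12.energy_eq]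
  positivity

theorem bddBelow_energy_image (V : Eu N → ℝ) :
    BddBelow (energy '' {u : D12 N | potential V u = 1}) := by
  refine ⟨0, ?_⟩
  rintro _ ⟨v, -, rfl⟩
  rw [D12.energy_eq]
  positivity

theorem groundEnergy_le_energy {u : D12 N} (hu : potential V u = 1) :
    groundEnergy V ≤ energy u :=
  csInf_le (bddBelow_energy_image V) ⟨u, hu, rfl⟩

/-- The homogeneous form of the definition of the ground energy. -/
theorem groundEnergy_mul_potential_le (V : Eu N → ℝ) (u : D12 N) :
    groundEnergy V * potential V u ≤ ‖u‖ ^ 2 := by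
  rcases le_or_gt (potential V u) 0 with hp | hp
  · exact (mul_nonpos_of_nonneg_of_nonpos (groundEnergy_nonneg V) hp).trans (sq_nonneg _)
  · set c := (Real.sqrt (potential V u))⁻¹ with hc
    have hc2 : c ^ 2 = (potential V u)⁻¹ := by rw [hc, inv_pow, Real.sq_sqrt hp.le]
    have h1 : potential V (c • u) = 1 := by
      rw [potential_smul, hc2, inv_mul_cancel₀ hp.ne']
    have h2 := groundEnergy_le_energy h1
    rw [D12.energy_eq, norm_smul, mul_pow, Real.norm_eq_abs, sq_abs, hc2,
      ← div_eq_inv_mul, le_div_iff₀ hp] at h2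
    exact h2

/-! ### Existence of minimizing sequences -/

theorem D12.exists_ae_eq_of_test {φ : Eu N → ℝ} (hφ : ContDiff ℝ ∞ φ)
    (hφc : HasCompactSupport φ) :
    ∃ u : D12 N, ⇑(D12.incl u).1 =ᵐ[volume] φ := by
  have h1 : MemLp φ (critExp N : ℝ≥0∞) volume :=
    hφ.continuous.memLp_of_hasCompactSupport hφc
  have hc : Continuous (gradient φ) :=
    (InnerProductSpace.toDual ℝ (Eu N)).symm.continuous.comp (hφ.continuous_fderiv (by simp))
  have hs : HasCompactSupport (gradient φ) :=
    (hφc.fderiv (𝕜 := ℝ)).comp_left (map_zero (InnerProductSpace.toDual ℝ (Eu N)).symm)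
  have h2 : MemLp (gradient φ) 2 volume := hc.memLp_of_hasCompactSupport hs
  exact ⟨⟨(h1.toLp, h2.toLp), Submodule.le_topologicalClosure _
    ⟨φ, hφ, hφc, h1.coeFn_toLp, h2.coeFn_toLp⟩⟩, h1.coeFn_toLp⟩

/-- Testing a potential with a bump `f` equal to `1` on its inner ball bounds `∫ V f²` from below by
the value of `V` at the centre, up to the oscillation of `V` around that value. -/
theorem le_integral_mul_bump_sq {N : ℕ} {V : Eu N → ℝ} (hV : LocallyIntegrable V volume)
    {x : Eu N} (hx : 0 ≤ V x) (f : ContDiffBump x) :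
    V x * volume.real (Metric.closedBall x f.rIn) -
      ∫ y in Metric.closedBall x f.rOut, ‖V y - V x‖ ≤ ∫ y, V y * f y ^ 2 := by
  set B := Metric.closedBall x f.rOut with hB
  set b := Metric.closedBall x f.rIn with hb
  have hs2 : HasCompactSupport fun y => f y ^ 2 :=
    f.hasCompactSupport.comp_left (g := fun t : ℝ => t ^ 2) (by simp)
  have hVB : IntegrableOn V B := hV.integrableOn_isCompact (isCompact_closedBall x f.rOut)
  have hcB : IntegrableOn (fun _ : Eu N => V x) B :=
    integrableOn_const measure_closedBall_lt_top.ne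
  have hdiff : IntegrableOn (fun y => ‖V y - V x‖) B := (hVB.sub hcB).norm
  have hf2 : Integrable fun y => f y ^ 2 :=
    (f.continuous.pow 2).integrable_of_hasCompactSupport hs2
  have hVf : Integrable fun y => V y * f y ^ 2 := by
    refine (hV.integrable_smul_left_of_hasCompactSupport (f.continuous.pow 2) hs2).congr
      (Eventually.of_forall fun y => ?_)
    exact mul_comm _ _
  have hzero : ∀ y ∉ B, f y = 0 := fun y hy =>
    f.zero_of_le_dist (not_le.1 fun h => hy (Metric.mem_closedBall.2 h)).le
  have hf1 : volume.real b ≤ ∫ y in B, f y ^ 2 := by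
    calc volume.real b = ∫ y in b, (1 : ℝ) := by simp
      _ = ∫ y in b, f y ^ 2 := by
        refine setIntegral_congr_fun Metric.isClosed_closedBall.measurableSet fun y hy => ?_
        simp only [f.one_of_mem_closedBall hy, one_pow]
      _ ≤ ∫ y in B, f y ^ 2 :=
        setIntegral_mono_set hf2.integrableOn (Eventually.of_forall fun y => sq_nonneg _)
          (Metric.closedBall_subset_closedBall f.rIn_lt_rOut.le).eventuallyLE
  have hset : ∫ y in B, V y * f y ^ 2 = ∫ y, V y * f y ^ 2 :=
    setIntegral_eq_integral_of_forall_compl_eq_zero fun y hy => by simp [hzero y hy]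
  have hlow : ∫ y in B, (V x * f y ^ 2 - ‖V y - V x‖) ≤ ∫ y in B, V y * f y ^ 2 := by
    refine integral_mono ((hf2.integrableOn.const_mul _).sub hdiff) hVf.integrableOn fun y => ?_
    have h1 : f y ^ 2 ≤ 1 := pow_le_one₀ f.nonneg f.le_one
    have h2 := neg_abs_le (V y - V x)
    have h3 := abs_nonneg (V y - V x)
    simp only [Real.norm_eq_abs]
    nlinarith [sq_nonneg (f y)]
  rw [integral_sub (hf2.integrableOn.const_mul _) hdiff, integral_const_mul, hset] at hlow
  linarith [mul_le_mul_of_nonneg_left hf1 hx]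

/-- The test function is a bump on a small ball around a Lebesgue point at which `V` is positive. -/
theorem exists_potential_pos (hV : LocallyIntegrable V volume)
    (hpos : 0 < volume {x | 0 < V x}) : ∃ u : D12 N, 0 < potential V u := by
  obtain ⟨x, hx, hleb⟩ := ((frequently_ae_iff (μ := (volume : Measure (Eu N)))
    (p := fun x => 0 < V x)).2 hpos.ne').and_eventually
    (IsUnifLocDoublingMeasure.ae_tendsto_average_norm_sub volume hV 1) |>.exists
  have hseq : Tendsto (fun n : ℕ => 1 / ((n : ℝ) + 1)) atTop (𝓝[>] 0) :=
    tendsto_nhdsWithin_iff.2 ⟨tendsto_one_div_add_atTop_nhds_zero_nat,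
      Eventually.of_forall fun n => Set.mem_Ioi.2 Nat.one_div_pos_of_nat⟩
  have hav := hleb (fun _ : ℕ => x) (fun n : ℕ => 1 / ((n : ℝ) + 1)) hseq
    (Eventually.of_forall fun n => Metric.mem_closedBall_self (by positivity))
  -- Halving the radius of a ball divides its volume by `2 ^ N`.
  have hVx : 0 < V x * (1 / 2) ^ N := mul_pos hx (by positivity)
  obtain ⟨r, hr0, hr⟩ : ∃ r : ℝ, 0 < r ∧
      ⨍ y in Metric.closedBall x r, ‖V y - V x‖ < V x * (1 / 2) ^ N := by
    obtain ⟨n, hn⟩ := (hav.eventually_lt_const hVx).exists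
    exact ⟨_, Nat.one_div_pos_of_nat, hn⟩
  have hvol : volume.real (Metric.closedBall x (r / 2)) =
      (1 / 2) ^ N * volume.real (Metric.closedBall x r) := by
    rw [Measure.addHaar_real_closedBall _ _ (by positivity),
      Measure.addHaar_real_closedBall _ _ hr0.le, finrank_euclideanSpace_fin]
    ring
  have hBpos : 0 < volume.real (Metric.closedBall x r) :=
    ENNReal.toReal_pos (Metric.measure_closedBall_pos _ _ hr0).ne' measure_closedBall_lt_top.ne
  let f : ContDiffBump x := ⟨r / 2, r, by positivity, by linarith⟩
  obtain ⟨u, hu⟩ := D12.exists_ae_eq_of_test (f.contDiff (n := (⊤ : ℕ∞))) f.hasCompactSupport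
  have hpot : potential V u = ∫ y, V y * f y ^ 2 :=
    integral_congr_ae (hu.mono fun y hy => by simp only [hy])
  refine ⟨u, ?_⟩
  have hlow : V x * volume.real (Metric.closedBall x (r / 2)) -
      ∫ y in Metric.closedBall x r, ‖V y - V x‖ ≤ ∫ y, V y * f y ^ 2 :=
    le_integral_mul_bump_sq hV hx.le f
  rw [setAverage_eq, smul_eq_mul, inv_mul_lt_iff₀ hBpos] at hr
  rw [hvol] at hlow
  rw [hpot]
  linarith

theorem exists_isMinimizingSeq (hV : LocallyIntegrable V volume)
    (hpos : 0 < volume {x | 0 < V x}) : ∃ u : ℕ → D12 N, IsMinimizingSeq V u := by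
  obtain ⟨u, hu⟩ := exists_potential_pos hV hpos
  have hne : (energy '' {u : D12 N | potential V u = 1}).Nonempty := by
    refine ⟨_, (Real.sqrt (potential V u))⁻¹ • u, ?_, rfl⟩
    rw [Set.mem_ofPred_eq, potential_smul, inv_pow, Real.sq_sqrt hu.le, inv_mul_cancel₀ hu.ne']
  obtain ⟨e, -, he, hmem⟩ := exists_seq_tendsto_sInf hne (bddBelow_energy_image V)
  choose v hv hve using hmem
  exact ⟨v, hv, by simpa only [hve] using! he⟩

/-! ### Compactness of minimizing sequences -/

/-- A weakly convergent minimizing sequence for `Λ₁ < Λ₀` converges strongly to a minimizer: energy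
and potential split between the weak limit and the remainder, and on the remainder `V₁` may be
replaced by `V₀`. A remainder that kept some potential would cost at least `Λ₀ > Λ₁` per unit of it,
which a minimizing sequence cannot afford. -/
theorem IsMinimizingSeq.tendsto_of_weakConv {V₀ V₁ : Eu N → ℝ}
    (hV₀ : MemWeakLorentz ((N : ℝ) / 2) V₀) (hV₁ : MemWeakLorentz ((N : ℝ) / 2) V₁)
    (hweak : WeaklyContinuous (fun u : D12 N => potential (fun x => V₁ x - V₀ x) u))
    (hlt : groundEnergy V₁ < groundEnergy V₀) {u : ℕ → D12 N} {w : D12 N}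
    (hu : IsMinimizingSeq V₁ u) (hw : WeakConv u w) :
    IsMinimizer V₁ w ∧ Tendsto u atTop (𝓝 w) := by
  have hen : Tendsto (fun k => ‖u k‖ ^ 2) atTop (𝓝 (groundEnergy V₁)) := by
    simpa only [D12.energy_eq] using hu.2
  have hb := hw.norm_sub_sq_tendsto hen
  have hp₁ := hw.potential_sub_tendsto hV₁ (c := 1) (by simp [hu.1])
  have hdiff : Tendsto (fun k => potential (fun x => V₁ x - V₀ x) (u k - w)) atTop (𝓝 0) := by
    have hzero : WeakConv (fun k => u k - w) 0 := fun ℓ => by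
      simpa using (hw ℓ).sub_const (ℓ w)
    simpa [potential] using hweak _ _ hzero
  have hp₀ : Tendsto (fun k => potential V₀ (u k - w)) atTop (𝓝 (1 - potential V₁ w)) := by
    have h := hp₁.sub hdiff
    rw [sub_zero] at h
    refine h.congr fun k => ?_
    rw [potential_sub_potential hV₀ hV₁]
    ring
  -- With `p = ∫ V₁ w²`: `Λ₀ (1 - p) ≤ Λ₁ - ‖w‖² ≤ Λ₁ (1 - p)`, so `1 ≤ p` and `‖w‖² = Λ₁`.
  have h1 : groundEnergy V₀ * (1 - potential V₁ w) ≤ groundEnergy V₁ - ‖w‖ ^ 2 :=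
    le_of_tendsto_of_tendsto' (hp₀.const_mul _) hb fun k => groundEnergy_mul_potential_le V₀ _
  have h2 := groundEnergy_mul_potential_le V₁ w
  have h3 : 1 ≤ potential V₁ w := by
    by_contra! h
    nlinarith
  have h4 : groundEnergy V₁ - ‖w‖ ^ 2 = 0 := by
    refine le_antisymm ?_ (ge_of_tendsto' hb fun k => sq_nonneg _)
    nlinarith [groundEnergy_nonneg V₁]
  rw [h4] at hb
  have hpw : potential V₁ w = 1 := by
    obtain ⟨C, -, hC⟩ := exists_abs_potential_le hV₁
    have hC0 := hb.const_mul C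
    rw [mul_zero] at hC0
    have h5 := tendsto_nhds_unique hp₁ (squeeze_zero_norm (fun k =>
      (norm_integral_le_integral_norm _).trans (hC (u k - w))) hC0)
    linarith
  refine ⟨⟨hpw, ?_⟩, ?_⟩
  · rw [D12.energy_eq]
    linarith
  · rw [tendsto_iff_norm_sub_tendsto_zero]
    simpa [Real.sqrt_sq (norm_nonneg _)] using hb.sqrt

end Potential

theorem mainTheorem4 {N : ℕ} [Fact (3 ≤ N)] (V₀ V₁ : Eu N → ℝ)
    (hV₀ : MemWeakLorentz ((N : ℝ) / 2) V₀) (hV₁ : MemWeakLorentz ((N : ℝ) / 2) V₁)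
    (hpos₀ : 0 < volume {x | 0 < V₀ x}) (hpos₁ : 0 < volume {x | 0 < V₁ x})
    (hweak : WeaklyContinuous (fun u : D12 N => potential (fun x => V₁ x - V₀ x) u))
    (hlt : groundEnergy V₁ < groundEnergy V₀) :
    (∃ w : D12 N, IsMinimizer V₁ w) ∧
      ∀ u : ℕ → D12 N, IsMinimizingSeq V₁ u →
        ∃ (ψ : ℕ → ℕ) (w : D12 N), StrictMono ψ ∧ IsMinimizer V₁ w ∧
          Tendsto (fun k => u (ψ k)) atTop (𝓝 w) := by
  have key : ∀ u : ℕ → D12 N, IsMinimizingSeq V₁ u →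
      ∃ (ψ : ℕ → ℕ) (w : D12 N), StrictMono ψ ∧ IsMinimizer V₁ w ∧
        Tendsto (fun k => u (ψ k)) atTop (𝓝 w) := by
    intro u hu
    obtain ⟨R, hR⟩ := hu.2.bddAbove_range
    have hbound : ∀ k, ‖u k‖ ≤ Real.sqrt R := fun k =>
      Real.le_sqrt_of_sq_le ((D12.energy_eq (u k)).symm.le.trans (hR ⟨k, rfl⟩))
    obtain ⟨ψ, w, hψ, hw⟩ := D12.exists_subseq_weakConv hbound
    have hsub : IsMinimizingSeq V₁ fun k => u (ψ k) :=
      ⟨fun k => hu.1 _, hu.2.comp hψ.tendsto_atTop⟩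
    have h := hsub.tendsto_of_weakConv hV₀ hV₁ hweak hlt hw
    exact ⟨ψ, w, hψ, h⟩
  obtain ⟨u, hu⟩ := exists_isMinimizingSeq hV₁.1 hpos₁
  obtain ⟨-, w, -, hw, -⟩ := key u hu
  exact ⟨⟨w, hw⟩, key⟩
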